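/- Let $1\le n<m$, let $A\in\mathbb{R}^{m\times n}$ have full column rank, and let $A=QR$ be a (thin) QR factorization, i.e. $Q\in\mathbb{R}^{m\times n}$ satisfies $Q^{T}Q=I$ and $R\in\mathbb{R}^{n\times n}$ is upper triangular. Let $P_Q$ and $P_Q^{\perp}$ be the orthogonal projections of $\mathbb{R}^m$ onto the column space $\mathrm{span}(Q)$ and onto its orthogonal complement. Let $X\in\mathrm{span}(Q)^{\perp}$ be a fixed vector, let $\sigma>0$, and let $Y$ be a random vector in $\mathbb{R}^m$ whose components are i.i.d. $N(0,\sigma^2)$. Put $$ r=\frac{P_Q^{\perp}(X+Y)}{\sqrt{\|P_Q^{\perp}(X+Y)\|_2^2+\|P_QY\|_2^2}} $$ (the denominator is nonzero almost surely). Then for all $\varepsilon_1\ge 0$ and $\varepsilon_2>0$, $$ \mathbb{P}\left(\|r\|_2\ge\frac{1}{\sqrt{1+(\varepsilon_1/\varepsilon_2)^2}}\right)=F'_{m-n,\,n}\left(\frac{n\,\varepsilon_2^2}{(m-n)\,\varepsilon_1^2};\ \frac{\|X\|_2^2}{\sigma^2}\right). $$ Here, for $x\in[0,\infty]$, $F'_{d_1,d_2}(x;\lambda)=\mathbb{P}(W\ge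 x)=1-\mathbb{P}(W<x)$ denotes the upper tail of the noncentral F-distribution with $d_1,d_2$ degrees of freedom and noncentrality parameter $\lambda$, i.e. of the law of $W=\frac{U/d_1}{V/d_2}$, where $U$ and $V$ are independent, $U$ is noncentral chi-squared with $d_1$ degrees of freedom and noncentrality $\lambda$ (the sum of squares of $d_1$ independent unit-variance normal variables whose squared means sum to $\lambda$) and $V$ is chi-squared with $d_2$ degrees of freedom. For $\varepsilon_1=0$ the argument of $F'$ is $+\infty$ and $F'_{d_1,d_2}(+\infty;\lambda)=0$. -/

import Mathlib

open MeasureTheory ProbabilityTheory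
open scoped ENNReal NNReal

noncomputable section

/-- The noncentral chi-squared distribution with `k ≥ 1` degrees of freedom and noncentrality
parameter `lam ≥ 0`: the law of `Z₁² + ⋯ + Z_k²`, where the `Z_i` are independent normal random
variables of variance `1` whose means have squares summing to `lam`.  By rotation invariance of the
Gaussian law only the sum of the squared means matters; here all the means are `√(lam / k)`. -/
def noncentralChiSq (k : ℕ) (lam : ℝ) : Measure ℝ :=
  (Measure.pi fun _ : Fin k => gaussianReal (√(lam / k)) 1).map fun z => ∑ i, z i ^ 2

/-- The (central) chi-squared distribution with `k` degrees of freedom: the law of the sum of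
squares of `k` independent standard normal random variables. -/
def chiSq (k : ℕ) : Measure ℝ :=
  (Measure.pi fun _ : Fin k => gaussianReal 0 1).map fun z => ∑ i, z i ^ 2

/-- The noncentral F-distribution with `d₁, d₂ ≥ 1` degrees of freedom and noncentrality parameter
`lam`: the law of `(U / d₁) / (V / d₂)` for independent `U`, `V`, where `U` is noncentral
chi-squared `(d₁, lam)` and `V` is chi-squared `d₂`. -/
def noncentralF (d₁ d₂ : ℕ) (lam : ℝ) : Measure ℝ :=
  ((noncentralChiSq d₁ lam).prod (chiSq d₂)).map fun p => (p.1 / d₁) / (p.2 / d₂)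

/-- The upper tail `F'_{d₁,d₂}(x; lam) = 1 - ℙ(W < x) = ℙ(W ≥ x)` of a random variable `W` with the
noncentral F-distribution, for a threshold `x ∈ [0, ∞]`; it vanishes at `x = ∞`. -/
def noncentralFTail (d₁ d₂ : ℕ) (x : ℝ≥0∞) (lam : ℝ) : ℝ≥0∞ :=
  noncentralF d₁ d₂ lam {t : ℝ | x ≤ ENNReal.ofReal t}

/-- `A = Q R` is a (thin) QR factorization: `Q` has orthonormal columns and `R` is upper
triangular. -/
structure IsQRFactorization {m n : ℕ} (A Q : Matrix (Fin m) (Fin n) ℝ)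
    (R : Matrix (Fin n) (Fin n) ℝ) : Prop where
  orthonormal : Q.transpose * Q = 1
  upper : ∀ i j, j < i → R i j = 0
  mul_eq : A = Q * R

/-- The column space of `Q` as a subspace of Euclidean space. -/
def colSpan {m n : ℕ} (Q : Matrix (Fin m) (Fin n) ℝ) : Submodule ℝ (EuclideanSpace ℝ (Fin m)) :=
  Submodule.span ℝ (Set.range fun j => WithLp.toLp 2 fun i => Q i j)

/-- The vector `P_Q^⊥(x + y) / √(‖P_Q^⊥(x + y)‖² + ‖P_Q y‖²)`, with `P_Q` and `P_Q^⊥` the orthogonal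
projections onto the column space of `Q` and onto its orthogonal complement. -/
def noisyResidual {m n : ℕ} (Q : Matrix (Fin m) (Fin n) ℝ) (x y : EuclideanSpace ℝ (Fin m)) :
    EuclideanSpace ℝ (Fin m) :=
  (√(‖(colSpan Q)ᗮ.starProjection (x + y)‖ ^ 2 + ‖(colSpan Q).starProjection y‖ ^ 2))⁻¹ •
    (colSpan Q)ᗮ.starProjection (x + y)

end

/-! In an orthonormal basis adapted to `colSpan Q` and its complement, `σ⁻¹ • Y` has independent
standard normal coordinates: `z` on the complement, `w` on the column space. The two squared norms
in the residual are then `σ ^ 2 * a` and `σ ^ 2 * b`, with `a` the sum of squares of the shifted `z`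
and `b` that of `w`, so `‖r‖ ^ 2 = a / (a + b)`. This is monotone in `a / b`, and the threshold
becomes one on the F-quotient (`threshold_iff`). Since `noncentralChiSq` uses equal means, the basis
of the complement is chosen to give `X` equal coordinates (`exists_orthonormalBasis_sum_eq`). Both
sides are then the same event, up to a null set, under one product Gaussian measure. -/

/-- A finite-dimensional inner product space has an orthonormal basis in which all the coordinates
of a given vector coincide. -/
theorem exists_orthonormalBasis_sum_eq {W : Type*} [NormedAddCommGroup W] [InnerProductSpace ℝ W]
    [FiniteDimensional ℝ W] {k : ℕ} (hk : 0 < k) (hW : Module.finrank ℝ W = k) (x : W) :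
    ∃ b : OrthonormalBasis (Fin k) ℝ W, x = ∑ i, (‖x‖ / √k) • b i := by
  let e := (stdOrthonormalBasis ℝ W).reindex (finCongr hW)
  let v : W := ∑ i, (‖x‖ / √k) • e i
  have hv : ‖v‖ = ‖x‖ := by
    rw [← sq_eq_sq₀ (norm_nonneg _) (norm_nonneg _), ← e.sum_sq_inner_right v]
    have : ∀ i, inner ℝ (e i) v = ‖x‖ / √k := fun i => by
      simp only [v]
      rw [e.orthonormal.inner_right_fintype]
    simp only [this, div_pow, Finset.sum_const, Finset.card_univ, Fintype.card_fin, nsmul_eq_mul]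
    rw [Real.sq_sqrt (by positivity)]
    field_simp
  -- As `‖v‖ = ‖x‖`, the reflection in the hyperplane orthogonal to `v - x` carries `v` to `x`, and
  -- hence `e` to the required basis.
  refine ⟨e.map (Submodule.reflection (Submodule.span ℝ {v - x})ᗮ), ?_⟩
  refine (Submodule.reflection_sub hv).symm.trans ?_
  conv_lhs => enter [2]; simp only [v]
  simp only [map_sum, map_smul, OrthonormalBasis.map_apply]

theorem measurable_noisyResidual {m n : ℕ} (Q : Matrix (Fin m) (Fin n) ℝ)
    (x : EuclideanSpace ℝ (Fin m)) : Measurable (noisyResidual Q x) := by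
  unfold noisyResidual
  fun_prop

/-- The columns of a matrix with orthonormal columns span a space of dimension their number. -/
theorem finrank_colSpan {m n : ℕ} {Q : Matrix (Fin m) (Fin n) ℝ} (hQ : Q.transpose * Q = 1) :
    Module.finrank ℝ (colSpan Q) = n := by
  have h : Orthonormal ℝ fun j => (WithLp.toLp 2 fun i => Q i j : EuclideanSpace ℝ (Fin m)) := by
    rw [orthonormal_iff_ite]
    intro i j
    have := congrFun (congrFun hQ i) j
    simp only [Matrix.mul_apply, Matrix.transpose_apply, Matrix.one_apply] at this
    simpa [PiLp.inner_apply, mul_comm] using this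
  exact (finrank_span_eq_card h.linearIndependent).trans (Fintype.card_fin n)

/-- The standard Gaussian measure in coordinates adapted to a subspace and its orthogonal
complement. -/
theorem stdGaussian_eq_map_prod {E : Type*} [NormedAddCommGroup E] [InnerProductSpace ℝ E]
    [FiniteDimensional ℝ E] [MeasurableSpace E] [BorelSpace E] (V : Submodule ℝ E) {k n : ℕ}
    (b : OrthonormalBasis (Fin k) ℝ Vᗮ) (c : OrthonormalBasis (Fin n) ℝ V) :
    stdGaussian E =
      ((Measure.pi fun _ : Fin k => gaussianReal 0 1).prod
        (Measure.pi fun _ : Fin n => gaussianReal 0 1)).map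
        fun p => ((∑ i, p.1 i • b i : Vᗮ) : E) + ((∑ j, p.2 j • c j : V) : E) := by
  let v : Fin k ⊕ Fin n → E := Sum.elim (fun i => (b i : E)) (fun j => (c j : E))
  have hv : Orthonormal ℝ v := by
    rw [orthonormal_iff_ite]
    rintro (i | i) (j | j)
    · simpa [v] using orthonormal_iff_ite.1 b.orthonormal i j
    · simpa [v] using V.inner_left_of_mem_orthogonal (c j).2 (b i).2
    · simpa [v] using V.inner_right_of_mem_orthogonal (c i).2 (b j).2
    · simpa [v] using orthonormal_iff_ite.1 c.orthonormal i j
  have hspan : ⊤ ≤ Submodule.span ℝ (Set.range v) := by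
    refine (hv.linearIndependent.span_eq_top_of_card_eq_finrank' ?_).ge
    have h1 := Module.finrank_eq_card_basis b.toBasis
    have h2 := Module.finrank_eq_card_basis c.toBasis
    have h3 := V.finrank_add_finrank_orthogonal
    simp only [Fintype.card_sum, Fintype.card_fin] at *
    omega
  rw [stdGaussian_eq_map_pi_orthonormalBasis (OrthonormalBasis.mk hv hspan),
    ← (measurePreserving_sumPiEquivProdPi
      fun _ : Fin k ⊕ Fin n => gaussianReal 0 1).map_eq,
    Measure.map_map (by fun_prop) (by fun_prop)]
  congr 1
  ext x
  simp [v, MeasurableEquiv.sumPiEquivProdPi]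

/-- The projection kills `w`, and Parseval in `b` does the rest. It serves for both the column space
and its complement. -/
theorem norm_starProjection_orthogonal_sq {E : Type*} [NormedAddCommGroup E]
    [InnerProductSpace ℝ E] [FiniteDimensional ℝ E] (V : Submodule ℝ E) {ι : Type*} [Fintype ι]
    (b : OrthonormalBasis ι ℝ V) (u w : E) (z : ι → ℝ) (hw : w ∈ Vᗮ)
    (hu : u = w + (∑ i, z i • b i : V)) : ‖V.starProjection u‖ ^ 2 = ∑ i, z i ^ 2 := by
  rw [hu, map_add, (Submodule.starProjection_apply_eq_zero_iff V).2 hw, zero_add,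
    Submodule.starProjection_eq_self_iff.2 (Subtype.coe_prop _), ← Submodule.coe_norm,
    ← b.sum_sq_inner_right]
  exact Finset.sum_congr rfl fun i _ => by rw [b.orthonormal.inner_right_fintype]

/-- The law of a vector with independent `N(0, σ²)` components. -/
theorem hasLaw_inv_smul_stdGaussian {m : ℕ} {σ : ℝ} (hσ : 0 < σ) {Ω : Type*} [MeasurableSpace Ω]
    {P : Measure Ω} [IsProbabilityMeasure P] {Y : Ω → EuclideanSpace ℝ (Fin m)}
    (hY : ∀ i, HasLaw (fun ω => Y ω i) (gaussianReal 0 ⟨σ ^ 2, sq_nonneg σ⟩) P)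
    (hYind : iIndepFun (fun i ω => Y ω i) P) :
    HasLaw (fun ω => σ⁻¹ • Y ω) (stdGaussian (EuclideanSpace ℝ (Fin m))) P := by
  have h : ∀ i, HasLaw (fun ω => σ⁻¹ * Y ω i) (gaussianReal 0 1) P := fun i => by
    convert gaussianReal_const_mul (hY i) σ⁻¹ using 2
    · simp
    · ext
      change (1 : ℝ) = (σ⁻¹) ^ 2 * σ ^ 2
      field_simp
  have hpi := (hYind.comp (fun _ t => σ⁻¹ * t) fun _ => by fun_prop).hasLaw_pi h
  rw [← map_pi_eq_stdGaussian]
  exact HasLaw.comp (Y := WithLp.toLp 2) ⟨by fun_prop, rfl⟩ hpi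

/-- Translating the means out of the Gaussians leaves the centred product measure that
`stdGaussian_eq_map_prod` also produces. -/
theorem noncentralFTail_eq_prod (d₁ d₂ : ℕ) (x : ℝ≥0∞) (lam : ℝ) :
    noncentralFTail d₁ d₂ x lam =
      ((Measure.pi fun _ : Fin d₁ => gaussianReal 0 1).prod
        (Measure.pi fun _ : Fin d₂ => gaussianReal 0 1))
        {p | x ≤ ENNReal.ofReal
          (((∑ i, (p.1 i + √(lam / d₁)) ^ 2) / d₁) / ((∑ j, p.2 j ^ 2) / d₂))} := by
  have h : (Measure.pi fun _ : Fin d₁ => gaussianReal (√(lam / d₁)) 1) =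
      (Measure.pi fun _ : Fin d₁ => gaussianReal 0 1).map fun z i => z i + √(lam / d₁) := by
    have := Measure.pi_map_pi (μ := fun _ : Fin d₁ => gaussianReal 0 1)
      (f := fun _ t => t + √(lam / d₁)) (fun _ => by fun_prop)
    rw [this]
    simp [gaussianReal_map_add_const]
  rw [noncentralFTail, noncentralF, noncentralChiSq, chiSq, h,
    Measure.map_map (by fun_prop) (by fun_prop),
    Measure.map_prod_map _ _ (by fun_prop) (by fun_prop),
    Measure.map_map (by fun_prop) (by fun_prop), Measure.map_apply (by fun_prop)
      (measurableSet_le (by fun_prop) (by fun_prop))]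
  rfl

/-- Over `n ≥ 1` coordinates, the sum of squares of standard normal variables is almost surely
positive. -/
theorem ae_sum_sq_pos {n : ℕ} (hn : 1 ≤ n) :
    ∀ᵐ w ∂(Measure.pi fun _ : Fin n => gaussianReal 0 1), 0 < ∑ j, w j ^ 2 := by
  have : NullSingletonClass (gaussianReal 0 1) := nullSingletonClass_gaussianReal one_ne_zero
  have h : ∀ᵐ w ∂(Measure.pi fun _ : Fin n => gaussianReal 0 1), w ⟨0, hn⟩ ≠ 0 :=
    (measurePreserving_eval (fun _ : Fin n => gaussianReal 0 1) ⟨0, hn⟩).quasiMeasurePreserving.ae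
      (Measure.ae_ne _ 0)
  filter_upwards [h] with w hw
  exact Finset.sum_pos' (fun _ _ => sq_nonneg _) ⟨_, Finset.mem_univ _, by positivity⟩

/-- For `b > 0` the threshold on the normalized residual is a threshold on the quotient `a / b`. -/
theorem threshold_iff {a b ε₁ ε₂ d₁ d₂ σ : ℝ} (ha : 0 ≤ a) (hb : 0 < b) (hε₁ : 0 ≤ ε₁)
    (hε₂ : 0 < ε₂) (hd₁ : 0 < d₁) (hd₂ : 0 < d₂) (hσ : 0 < σ) :
    1 / √(1 + (ε₁ / ε₂) ^ 2) ≤ (√(σ ^ 2 * a + σ ^ 2 * b))⁻¹ * √(σ ^ 2 * a) ↔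
      ENNReal.ofReal (d₂ * ε₂ ^ 2) / ENNReal.ofReal (d₁ * ε₁ ^ 2) ≤
        ENNReal.ofReal ((a / d₁) / (b / d₂)) := by
  have h1 : 1 / √(1 + (ε₁ / ε₂) ^ 2) = √(1 / (1 + (ε₁ / ε₂) ^ 2)) := by
    rw [Real.sqrt_div' _ (by positivity), Real.sqrt_one]
  have h2 : (√(σ ^ 2 * a + σ ^ 2 * b))⁻¹ * √(σ ^ 2 * a) = √(a / (a + b)) := by
    rw [← Real.sqrt_inv, ← Real.sqrt_mul (by positivity)]
    congr 1
    field_simp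
  have h3 : 1 / (1 + (ε₁ / ε₂) ^ 2) ≤ a / (a + b) ↔ b * ε₂ ^ 2 ≤ a * ε₁ ^ 2 := by
    rw [div_le_div_iff₀ (by positivity) (by positivity), div_pow, ← sub_nonneg,
      ← sub_nonneg (b := b * ε₂ ^ 2),
      show a * (1 + ε₁ ^ 2 / ε₂ ^ 2) - 1 * (a + b) = (a * ε₁ ^ 2 - b * ε₂ ^ 2) / ε₂ ^ 2 by
        field_simp; ring]
    exact ⟨fun h => by simpa using (le_div_iff₀ (by positivity)).1 h, fun h => by positivity⟩
  rw [h1, h2, Real.sqrt_le_sqrt_iff (by positivity), h3]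
  rcases hε₁.eq_or_lt with rfl | hε₁
  -- Here the threshold is `∞`, and both sides are false because `b > 0`.
  · have : ENNReal.ofReal (d₂ * ε₂ ^ 2) ≠ 0 := by
      rw [Ne, ENNReal.ofReal_eq_zero, not_le]; positivity
    simp [ENNReal.div_zero this]
    positivity
  · rw [← ENNReal.ofReal_div_of_pos (by positivity),
      ENNReal.ofReal_le_ofReal_iff (by positivity), div_div_div_eq,
      div_le_div_iff₀ (by positivity) (by positivity), ← sub_nonneg, ← sub_nonneg (b := _ * (d₁ * b)),
      show a * d₂ * (d₁ * ε₁ ^ 2) - d₂ * ε₂ ^ 2 * (d₁ * b) =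
        (a * ε₁ ^ 2 - b * ε₂ ^ 2) * (d₁ * d₂) by ring]
    exact (mul_nonneg_iff_of_pos_right (by positivity)).symm

theorem mainTheorem5 {m n : ℕ} (hn : 1 ≤ n) (hmn : n < m)
    (A Q : Matrix (Fin m) (Fin n) ℝ) (R : Matrix (Fin n) (Fin n) ℝ)
    (hA : A.rank = n) (hQR : IsQRFactorization A Q R)
    (X : EuclideanSpace ℝ (Fin m)) (hX : X ∈ (colSpan Q)ᗮ)
    (σ : ℝ) (hσ : 0 < σ)
    {Ω : Type*} [MeasurableSpace Ω] (P : Measure Ω) [IsProbabilityMeasure P]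
    (Y : Ω → EuclideanSpace ℝ (Fin m))
    (hY : ∀ i, HasLaw (fun ω => Y ω i) (gaussianReal 0 ⟨σ ^ 2, sq_nonneg σ⟩) P)
    (hYind : iIndepFun (fun i ω => Y ω i) P)
    (ε₁ ε₂ : ℝ) (hε₁ : 0 ≤ ε₁) (hε₂ : 0 < ε₂) :
    P {ω | 1 / √(1 + (ε₁ / ε₂) ^ 2) ≤ ‖noisyResidual Q X (Y ω)‖} =
      noncentralFTail (m - n) n
        (ENNReal.ofReal (n * ε₂ ^ 2) / ENNReal.ofReal (((m : ℝ) - n) * ε₁ ^ 2))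
        (‖X‖ ^ 2 / σ ^ 2) := by
  have hV := finrank_colSpan hQR.orthonormal
  have hW : Module.finrank ℝ (colSpan Q)ᗮ = m - n := by
    have := (colSpan Q).finrank_add_finrank_orthogonal
    rw [hV, finrank_euclideanSpace_fin] at this
    omega
  have hk : 0 < m - n := by omega
  have hkR : (0 : ℝ) < (m - n : ℕ) := by exact_mod_cast hk
  have hnR : (0 : ℝ) < n := by exact_mod_cast hn
  obtain ⟨b, hb⟩ := exists_orthonormalBasis_sum_eq hk hW ⟨X, hX⟩
  let c : OrthonormalBasis (Fin n) ℝ (colSpan Q) :=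
    (stdOrthonormalBasis ℝ (colSpan Q)).reindex (finCongr hV)
  -- The common mean in `noncentralChiSq` for `lam = ‖X‖ ^ 2 / σ ^ 2`; the coordinates of `X` are `σ
  -- * μ`.
  set μ : ℝ := √(‖X‖ ^ 2 / σ ^ 2 / (m - n : ℕ)) with hμ
  have hXb : X = (∑ i, (σ * μ) • b i : (colSpan Q)ᗮ) := by
    have : σ * μ = ‖X‖ / √(m - n : ℕ) := by
      rw [hμ, Real.sqrt_div (by positivity), ← div_pow, Real.sqrt_sq (by positivity)]
      field_simp
    rw [this]
    exact congrArg Subtype.val hb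
  have hmeas : Measurable fun y => ‖noisyResidual Q X (σ • y)‖ :=
    ((measurable_noisyResidual Q X).comp (by fun_prop)).norm
  have hset : {ω | 1 / √(1 + (ε₁ / ε₂) ^ 2) ≤ ‖noisyResidual Q X (Y ω)‖} =
      {ω | 1 / √(1 + (ε₁ / ε₂) ^ 2) ≤ ‖noisyResidual Q X (σ • σ⁻¹ • Y ω)‖} := by
    simp [smul_smul, hσ.ne']
  rw [hset, (hasLaw_inv_smul_stdGaussian hσ hY hYind).measure_eq
      (p := fun y => 1 / √(1 + (ε₁ / ε₂) ^ 2) ≤ ‖noisyResidual Q X (σ • y)‖)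
      (measurableSet_le measurable_const hmeas),
    stdGaussian_eq_map_prod (colSpan Q) b c,
    Measure.map_apply (by fun_prop) (measurableSet_le measurable_const hmeas),
    noncentralFTail_eq_prod]
  refine measure_congr ?_
  -- Where `w = 0` the events can differ, since the F-quotient is then `0` by the convention for
  -- division; this set is null.
  filter_upwards [Measure.quasiMeasurePreserving_snd.ae (ae_sum_sq_pos hn)] with ⟨z, w⟩ hw
  have h1 : ‖(colSpan Q)ᗮ.starProjection (X + σ • (((∑ i, z i • b i : (colSpan Q)ᗮ) :
      EuclideanSpace ℝ (Fin m)) + (∑ j, w j • c j : colSpan Q)))‖ ^ 2 =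
      σ ^ 2 * ∑ i, (z i + μ) ^ 2 := by
    rw [norm_starProjection_orthogonal_sq _ b _ (σ • (∑ j, w j • c j : colSpan Q))
      (fun i => σ * (z i + μ)), Finset.mul_sum]
    · simp only [mul_pow]
    · rw [Submodule.orthogonal_orthogonal]
      exact Submodule.smul_mem _ _ (Subtype.coe_prop _)
    · nth_rw 1 [hXb]
      simp only [mul_add, add_smul, Finset.sum_add_distrib, mul_smul, ← Finset.smul_sum, smul_add,
        Submodule.coe_add, Submodule.coe_smul]
      abel
  have h2 : ‖(colSpan Q).starProjection (σ • (((∑ i, z i • b i : (colSpan Q)ᗮ) :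
      EuclideanSpace ℝ (Fin m)) + (∑ j, w j • c j : colSpan Q)))‖ ^ 2 =
      σ ^ 2 * ∑ j, w j ^ 2 := by
    rw [norm_starProjection_orthogonal_sq _ c _ (σ • (∑ i, z i • b i : (colSpan Q)ᗮ))
      (fun j => σ * w j), Finset.mul_sum]
    · simp only [mul_pow]
    · exact Submodule.smul_mem _ _ (Subtype.coe_prop _)
    · simp only [mul_smul, ← Finset.smul_sum, smul_add, Submodule.coe_smul]
  have key := threshold_iff (a := ∑ i, (z i + μ) ^ 2) (Finset.sum_nonneg fun _ _ => sq_nonneg _)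
    hw hε₁ hε₂ hkR hnR hσ
  rw [Nat.cast_sub hmn.le] at key
  refine propext (Iff.trans (iff_of_eq ?_) (key.trans (iff_of_eq ?_)))
  · change (_ ≤ ‖noisyResidual Q X _‖) = _
    rw [noisyResidual, norm_smul, h1, h2, ← h1, Real.sqrt_sq (norm_nonneg _), norm_inv,
      Real.norm_of_nonneg (Real.sqrt_nonneg _)]
  · change _ = (_ ≤ _)
    simp only [hμ, Nat.cast_sub hmn.le]
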